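/- For positive integers $m,k$ and a Boolean function $f:\{0,1\}^m\to\{0,1\}$ with exactly $k$ zeros, let $M_f$ be the $k\times m$ matrix whose rows are the distinct zeros of $f$. Let $\Phi^{m,k}$ be the set of those $f$ with exactly $k$ zeros that are reduced (no column of $M_f$ is constant, no two columns are equal, and no column is the coordinatewise negation of another one), that have no two zeros at Hamming distance $1$, and for which in each column of $M_f$ the number of ones does not exceed the number of zeros. A minimal DNF of $f$ is a disjunctive normal form of $f$ with the least number of literals, counted with repetitions. Let $\log$ be the natural logarithm, fix $0<\alpha<1$ and put $\lambda=\lambda_{m,k}=\alpha\sqrt{2\log m/k}$. "Almost all functions of $\Phi^{m,k}$" means that, as $m\to\infty$, the proportion of functions in $\Phi^{m,k}$ with the property tends to $1$, uniformly over all $k$ in the stated range for which $\Phi^{m,k}\neq\varnothing$. (i) For $\log m\le k/32$, for almost all functions of $\Phi^{m,k}$ every minimal DNF contains at least $$\frac{10}{3}m-\frac{5m(1-\lambda)}{3+3\lambda}$$ literals. (ii) For $k/162<\log m<k/32$, for almost all functions of $\Phi^{m,k}$ every minimal DNF contains at least $$\frac{10}{3}m-\frac{13m(1-\lambda)}{9+3\lambda}$$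 literals. -/

import Mathlib

namespace DNFBound

/-- Boolean functions of `m` variables. -/
abbrev BoolFun (m : ℕ) : Type := (Fin m → Bool) → Bool

/-- The zeros of `f`; they index the rows of its matrix of zeros. -/
abbrev Zero {m : ℕ} (f : BoolFun m) : Type := {x : Fin m → Bool // f x = false}

/-- The matrix of zeros `M_f`: its rows are the distinct zeros of `f`, its columns correspond to
the variables. -/
def zeroMatrix {m : ℕ} (f : BoolFun m) : Matrix (Zero f) (Fin m) Bool :=
  Matrix.of fun z i => z.1 i

/-- The `i`-th column of the matrix of zeros. -/
def zeroColumn {m : ℕ} (f : BoolFun m) (i : Fin m) : Zero f → Bool :=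
  fun z => zeroMatrix f z i

/-- The number of entries of the `i`-th column of the matrix of zeros that are equal to `b`. -/
def columnCount {m : ℕ} (f : BoolFun m) (i : Fin m) (b : Bool) : ℕ :=
  Fintype.card {z : Zero f // zeroColumn f i z = b}

/-- A reduced function: the matrix of zeros has no constant column, no two of its columns are
equal, and no column is the negation of another one. (Equal columns being absent, the requirement
that equal columns stand next to each other is void.) -/
structure IsReduced {m : ℕ} (f : BoolFun m) : Prop where
  not_constant : ∀ (i : Fin m) (b : Bool), zeroColumn f i ≠ fun _ => b
  distinct : ∀ i j : Fin m, i ≠ j → zeroColumn f i ≠ zeroColumn f j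
  not_complementary : ∀ i j : Fin m, i ≠ j → zeroColumn f i ≠ fun z => !(zeroColumn f j z)

/-- The class `Φ^{m,k}`: reduced functions of `m` variables with exactly `k` zeros, no two of which
are at Hamming distance 1, normalized so that in every column of the matrix of zeros the number of
ones does not exceed the number of zeros. -/
def Phi (m k : ℕ) : Set (BoolFun m) :=
  {f | IsReduced f ∧ Fintype.card (Zero f) = k ∧
    (∀ y z : Zero f, hammingDist y.1 z.1 ≠ 1) ∧
    ∀ i : Fin m, columnCount f i true ≤ columnCount f i false}

/-- An elementary conjunction in `m` variables: `K i = some true` if it contains the literal `x_i`,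
`K i = some false` if it contains the negated literal, `K i = none` if `x_i` does not occur. -/
abbrev Conjunction (m : ℕ) : Type := Fin m → Option Bool

/-- `K` takes the value 1 at the point `x`. -/
def Conjunction.Holds {m : ℕ} (K : Conjunction m) (x : Fin m → Bool) : Prop :=
  ∀ (i : Fin m) (b : Bool), K i = some b → x i = b

/-- The number of literals of a conjunction. -/
def Conjunction.rank {m : ℕ} (K : Conjunction m) : ℕ :=
  Fintype.card {i : Fin m // K i ≠ none}

/-- A disjunctive normal form: a finite set of elementary conjunctions. -/
abbrev DNF (m : ℕ) : Type := Finset (Conjunction m)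

/-- The rank of a DNF: the number of literals in it, counted with repetitions. -/
def DNF.rank {m : ℕ} (D : DNF m) : ℕ := ∑ K ∈ D, Conjunction.rank K

/-- `D` is a DNF of the function `f`. -/
def DNF.Realizes {m : ℕ} (D : DNF m) (f : BoolFun m) : Prop :=
  ∀ x : Fin m → Bool, f x = true ↔ ∃ K ∈ D, Conjunction.Holds K x

/-- `D` is a minimal DNF of `f`: a DNF of `f` of least rank. -/
def DNF.IsMinimal {m : ℕ} (D : DNF m) (f : BoolFun m) : Prop :=
  DNF.Realizes D f ∧ ∀ D' : DNF m, DNF.Realizes D' f → DNF.rank D ≤ DNF.rank D'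

/-- Almost all functions of `Φ^{m,k}` with `(m, k)` in the range `R` have the property `P`: as
`m → ∞`, the proportion of functions with the property tends to 1, uniformly over the `k` that
satisfy `R m k`. -/
def AlmostAll (R : ℕ → ℕ → Prop) (P : (m k : ℕ) → BoolFun m → Prop) : Prop :=
  ∀ δ : ℝ, 0 < δ → ∃ M : ℕ, ∀ m k : ℕ, M ≤ m → R m k →
    (1 - δ) * ((Phi m k).ncard : ℝ) ≤ (({f | f ∈ Phi m k ∧ P m k f} : Set (BoolFun m)).ncard : ℝ)

/-- The quantity `λ = α √(2 log m / k)`, with the natural logarithm. -/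
noncomputable def lam (α : ℝ) (m k : ℕ) : ℝ :=
  α * Real.sqrt (2 * Real.log (m : ℝ) / (k : ℝ))

end DNFBound

namespace DNFBound

/-! ### Lower bounds for the number of literals -/

open Finset

/-! Flipping one coordinate `i` of a zero `z` gives a point where `f` is 1, and a conjunction
covering that point must contain the literal of `x_i` that is false at `z`. Nonconstant columns thus
force both literals of every variable, so any DNF of `f` has at least `2m` literals
(`two_mul_le_rank`). If moreover `f` is independent, each positive literal occurs twice, giving `3m`
(`three_mul_le_rank`).

Both claimed bounds increase with `λ`. For `log m ≤ k/162` one has `λ ≤ 1/9`, where the bound of (i)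
is at most `2m`, so every function qualifies. For `k/162 < log m ≤ k/32` one has `λ ≤ 1/4`, where
both bounds are at most `7m/3 < 3m`, so it remains to see that almost all functions are independent
(`almostAll_isIndependent`).

This is a union bound. A function with its `k` zeros labelled is a sequence of `m` columns from a
set of size `h ≥ 2^k/4`. At most `2m²·3^k·h^(m-2)` sequences are dependent, and at least `h^m/2`
come from `Phi m k`. Each function has `k!` labellings, so the dependent share is at most `64/m`. -/

/-- The number of occurrences of the literal of `x_i` with sign `b` in `D`. -/
def DNF.occurrences {m : ℕ} (D : DNF m) (i : Fin m) (b : Bool) : ℕ :=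
  (D.filter fun K => K i = some b).card

theorem DNF.rank_eq_sum_occurrences {m : ℕ} (D : DNF m) :
    D.rank = ∑ i, (D.occurrences i true + D.occurrences i false) := by
  have h : ∀ K : Conjunction m, K.rank =
      ∑ i, ((if K i = some true then 1 else 0) + (if K i = some false then 1 else 0)) := by
    intro K
    rw [Conjunction.rank, Fintype.card_subtype, Finset.card_filter]
    refine Finset.sum_congr rfl fun i _ => ?_
    rcases K i with _ | _ | _ <;> simp
  simp only [DNF.rank, h, DNF.occurrences, Finset.card_filter, ← Finset.sum_add_distrib]
  exact Finset.sum_comm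

theorem hammingDist_update_not {m : ℕ} (z : Fin m → Bool) (i : Fin m) :
    hammingDist z (Function.update z i (!z i)) = 1 := by
  rw [hammingDist, Finset.card_eq_one]
  refine ⟨i, ?_⟩
  ext j
  by_cases h : j = i
  · subst h; simp
  · simp [h]

theorem apply_update_of_mem_Phi {m k : ℕ} {f : BoolFun m} (hf : f ∈ Phi m k) (z : Zero f)
    (i : Fin m) : f (Function.update z.1 i (!z.1 i)) = true := by
  by_contra h
  rw [Bool.not_eq_true] at h
  exact hf.2.2.1 z ⟨_, h⟩ (hammingDist_update_not z.1 i)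

/-- A neighbour of a zero is covered by a conjunction with the literal in which the two differ. -/
theorem exists_conjunction_of_zero {m k : ℕ} {f : BoolFun m} (hf : f ∈ Phi m k) {D : DNF m}
    (hD : D.Realizes f) (z : Zero f) (i : Fin m) :
    ∃ K ∈ D, K i = some (!z.1 i) ∧ ∀ j, j ≠ i → ∀ b, K j = some b → z.1 j = b := by
  obtain ⟨K, hK, hh⟩ := (hD _).1 (apply_update_of_mem_Phi hf z i)
  have hne : ∀ j, j ≠ i → ∀ b, K j = some b → z.1 j = b := by
    intro j hj b hb
    simpa [hj] using hh j b hb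
  refine ⟨K, hK, ?_, hne⟩
  by_contra hi
  have : f z.1 = true := by
    refine (hD _).2 ⟨K, hK, fun j b hb => ?_⟩
    by_cases hj : j = i
    · subst hj
      have := hh j b hb
      simp only [Function.update_self] at this
      exact absurd (this ▸ hb) hi
    · exact hne j hj b hb
  rw [z.2] at this
  exact Bool.false_ne_true this

theorem exists_zero_apply_eq {m k : ℕ} {f : BoolFun m} (hf : f ∈ Phi m k) (i : Fin m) (b : Bool) :
    ∃ z : Zero f, z.1 i = b := by
  by_contra! h
  refine hf.1.not_constant i (!b) (funext fun z => ?_)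
  have := h z
  change z.1 i = !b
  revert this
  cases z.1 i <;> cases b <;> simp

theorem one_le_occurrences {m k : ℕ} {f : BoolFun m} (hf : f ∈ Phi m k) {D : DNF m}
    (hD : D.Realizes f) (i : Fin m) (b : Bool) : 1 ≤ D.occurrences i b := by
  obtain ⟨z, hz⟩ := exists_zero_apply_eq hf i (!b)
  obtain ⟨K, hK, hi, -⟩ := exists_conjunction_of_zero hf hD z i
  refine Finset.card_pos.2 ⟨K, Finset.mem_filter.2 ⟨hK, ?_⟩⟩
  rw [hi, hz, Bool.not_not]

/-- No column of the matrix of zeros is constant on the rows where another column vanishes. -/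
def IsIndependent {m : ℕ} (f : BoolFun m) : Prop :=
  ∀ i j : Fin m, i ≠ j → ∀ b : Bool, ∃ z : Zero f, z.1 i = false ∧ z.1 j ≠ b

/-- If a single conjunction `K` contained `x_i`, it would cover the `i`-neighbours of all zeros with
`z_i = 0`. Any further literal of `K` would then be true at all these zeros, which independence
forbids. So `K` is just `x_i`, which also accepts the zeros with `z_i = 1`. -/
theorem two_le_occurrences {m k : ℕ} {f : BoolFun m} (hf : f ∈ Phi m k) (hI : IsIndependent f)
    {D : DNF m} (hD : D.Realizes f) (i : Fin m) : 2 ≤ D.occurrences i true := by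
  by_contra! hlt
  have hsub : ∀ K ∈ D, K i = some true → ∀ K' ∈ D, K' i = some true → K = K' := by
    intro K hK h K' hK' h'
    exact Finset.card_le_one.1 (Nat.lt_succ_iff.1 hlt) K (Finset.mem_filter.2 ⟨hK, h⟩) K'
      (Finset.mem_filter.2 ⟨hK', h'⟩)
  obtain ⟨z₀, hz₀⟩ := exists_zero_apply_eq hf i false
  obtain ⟨K, hK, hi, -⟩ := exists_conjunction_of_zero hf hD z₀ i
  rw [hz₀, Bool.not_false] at hi
  have honly : ∀ j, j ≠ i → K j = none := by
    intro j hj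
    by_contra hne
    obtain ⟨b, hb⟩ := Option.ne_none_iff_exists'.1 hne
    obtain ⟨z, hzi, hzj⟩ := hI i j hj.symm b
    obtain ⟨K', hK', hi', h'⟩ := exists_conjunction_of_zero hf hD z i
    rw [hzi, Bool.not_false] at hi'
    obtain rfl := hsub K hK hi K' hK' hi'
    exact hzj (h' j hj b hb)
  obtain ⟨z₁, hz₁⟩ := exists_zero_apply_eq hf i true
  have : f z₁.1 = true := by
    refine (hD _).2 ⟨K, hK, fun j b hb => ?_⟩
    by_cases hj : j = i
    · subst hj
      rw [hi] at hb
      rw [hz₁]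
      exact Option.some.inj hb
    · rw [honly j hj] at hb
      exact absurd hb (by simp)
  rw [z₁.2] at this
  exact Bool.false_ne_true this

theorem two_mul_le_rank {m k : ℕ} {f : BoolFun m} (hf : f ∈ Phi m k) {D : DNF m}
    (hD : D.Realizes f) : 2 * m ≤ D.rank := by
  rw [DNF.rank_eq_sum_occurrences]
  calc 2 * m = ∑ _i : Fin m, 2 := by simp [mul_comm]
    _ ≤ _ := Finset.sum_le_sum fun i _ => by
      have := one_le_occurrences hf hD i true
      have := one_le_occurrences hf hD i false
      omega

theorem three_mul_le_rank {m k : ℕ} {f : BoolFun m} (hf : f ∈ Phi m k) (hI : IsIndependent f)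
    {D : DNF m} (hD : D.Realizes f) : 3 * m ≤ D.rank := by
  rw [DNF.rank_eq_sum_occurrences]
  calc 3 * m = ∑ _i : Fin m, 3 := by simp [mul_comm]
    _ ≤ _ := Finset.sum_le_sum fun i _ => by
      have := two_le_occurrences hf hI hD i
      have := one_le_occurrences hf hD i false
      omega

/-! ### The set of allowed columns -/

open scoped Classical in
/-- The columns of length `k` allowed in a matrix of zeros: nonconstant, with at most as many ones
as zeros. -/
noncomputable def halfColumns (k : ℕ) : Finset (Fin k → Bool) :=
  univ.filter fun c => (∀ b : Bool, c ≠ fun _ => b) ∧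
    Fintype.card {r // c r = true} ≤ Fintype.card {r // c r = false}

theorem mem_halfColumns {k : ℕ} {c : Fin k → Bool} : c ∈ halfColumns k ↔
    (∀ b : Bool, c ≠ fun _ => b) ∧
      Fintype.card {r // c r = true} ≤ Fintype.card {r // c r = false} := by
  simp [halfColumns]

theorem mem_or_compl_mem_halfColumns {k : ℕ} {c : Fin k → Bool} {r s : Fin k} (h : c r ≠ c s) :
    c ∈ halfColumns k ∨ (fun t => !c t) ∈ halfColumns k := by
  have hc : ∀ b : Bool, c ≠ fun _ => b := by
    rintro b rfl
    exact h rfl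
  have hc' : ∀ b : Bool, (fun t => !c t) ≠ fun _ => b := by
    intro b hb
    apply h
    have h1 := congrFun hb r
    have h2 := congrFun hb s
    simpa using h1.trans h2.symm
  simp only [mem_halfColumns]
  rcases le_total (Fintype.card {r // c r = true}) (Fintype.card {r // c r = false}) with h | h
  · exact Or.inl ⟨hc, h⟩
  · refine Or.inr ⟨hc', ?_⟩
    simpa using h

/-- Half of all columns differ at `r` and `s`, a property invariant under negation, and such a
column or its negation is allowed. -/
theorem two_pow_le_card_disagree {k : ℕ} {r s : Fin k} (hrs : r ≠ s) :
    2 ^ k ≤ 4 * ((halfColumns k).filter fun c => c r ≠ c s).card := by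
  have h1 : (univ.filter fun c : Fin k → Bool => c r = c s).card ≤
      (univ.filter fun c : Fin k → Bool => c r ≠ c s).card := by
    -- Flipping entry `r` turns agreement into disagreement.
    refine Finset.card_le_card_of_injOn (fun c => Function.update c r (!c r)) ?_ ?_
    · intro c hc
      simp only [coe_filter, mem_univ, true_and, Set.mem_ofPred_eq] at hc
      simp [hrs.symm, hc]
    · intro c _ d _ h
      funext t
      have := congrFun h t
      by_cases ht : t = r
      · subst ht; simpa using this
      · simpa [ht] using this
  have h2 := Finset.card_filter_add_card_filter_not (s := (univ : Finset (Fin k → Bool)))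
    (fun c => c r = c s)
  have h3 : (univ.filter fun c : Fin k → Bool => c r ≠ c s).card ≤
      ((halfColumns k).filter fun c => c r ≠ c s).card +
      (((halfColumns k).filter fun c => c r ≠ c s).image fun c t => !c t).card := by
    refine (Finset.card_le_card ?_).trans (Finset.card_union_le _ _)
    intro c hc
    have hc' := (mem_filter.1 hc).2
    rcases mem_or_compl_mem_halfColumns hc' with h | h
    · exact mem_union_left _ (mem_filter.2 ⟨h, hc'⟩)
    · refine mem_union_right _ (mem_image.2 ⟨_, mem_filter.2 ⟨h, ?_⟩, ?_⟩)
      · simpa using hc'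
      · simp
  have h4 := Finset.card_image_le (s := (halfColumns k).filter fun c => c r ≠ c s)
    (f := fun c t => !c t)
  have h5 : (univ : Finset (Fin k → Bool)).card = 2 ^ k := by simp
  simp only [← ne_eq] at h2
  omega

theorem two_pow_le_card_halfColumns {k : ℕ} (hk : 2 ≤ k) : 2 ^ k ≤ 4 * (halfColumns k).card := by
  have h : (⟨0, by omega⟩ : Fin k) ≠ ⟨1, by omega⟩ := by simp
  refine (two_pow_le_card_disagree h).trans ?_
  gcongr
  exact filter_subset _ _

theorem card_agree_le {k : ℕ} {r s : Fin k} (hrs : r ≠ s) :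
    4 * ((halfColumns k).filter fun c => c r = c s).card ≤ 3 * (halfColumns k).card := by
  have h1 := two_pow_le_card_disagree hrs
  have h2 := Finset.card_filter_add_card_filter_not (s := halfColumns k) (fun c => c r = c s)
  have h3 : (halfColumns k).card ≤ 2 ^ k := by
    simpa using Finset.card_le_univ (halfColumns k)
  simp only [← ne_eq] at h2
  omega

/-! ### Counting dependent and degenerate column sequences -/

/-- The number of `m`-tuples whose entries at two given places are in a given relation. -/
theorem card_filter_pair_mul_sq_le {m : ℕ} {γ : Type*} [DecidableEq γ] (H : Finset γ)
    {i j : Fin m} (hij : i ≠ j) (R : Finset (γ × γ)) :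
    ((Fintype.piFinset fun _ : Fin m => H).filter fun A => (A i, A j) ∈ R).card * H.card ^ 2 ≤
      R.card * H.card ^ m := by
  have e : H.card ^ m = (Fintype.piFinset fun _ : Fin m => H).card := by simp
  rw [e, sq, ← Finset.card_product, ← Finset.card_product, ← Finset.card_product]
  refine Finset.card_le_card_of_injOn
    -- Exchange the entries at `i` and `j` with the free pair `(u, v)`; nothing is lost.
    (fun p => ((p.1 i, p.1 j), Function.update (Function.update p.1 i p.2.1) j p.2.2)) ?_ ?_
  · rintro ⟨A, u, v⟩ h
    simp only [coe_product, Set.mem_prod, mem_coe, mem_filter, Fintype.mem_piFinset] at h ⊢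
    refine ⟨h.1.2, fun l => ?_⟩
    by_cases hj : l = j
    · subst hj; simpa using h.2.2
    · by_cases hi : l = i
      · subst hi; simpa [hj] using h.2.1
      · simpa [hi, hj] using h.1.1 l
  · rintro ⟨A, u, v⟩ - ⟨B, u', v'⟩ - h
    simp only [Prod.mk.injEq] at h
    obtain ⟨⟨h1, h2⟩, h3⟩ := h
    have hu : u = u' := by simpa [hij] using congrFun h3 i
    have hv : v = v' := by simpa using congrFun h3 j
    have hA : A = B := by
      funext l
      by_cases hj : l = j
      · subst hj; exact h2
      · by_cases hi : l = i
        · subst hi; exact h1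
        · simpa [hi, hj] using congrFun h3 l
    rw [hu, hv, hA]

/-- In each row exactly three of the four pairs of bits are admissible. -/
theorem card_implication_le (k : ℕ) (b : Bool) :
    (univ.filter fun p : (Fin k → Bool) × (Fin k → Bool) =>
      ∀ r, p.1 r = false → p.2 r = b).card ≤ 3 ^ k := by
  have h3 : (univ.filter fun q : Bool × Bool => q.1 = false → q.2 = b).card = 3 := by
    cases b <;> decide
  have e : 3 ^ k = (Fintype.piFinset fun _ : Fin k =>
      univ.filter fun q : Bool × Bool => q.1 = false → q.2 = b).card := by
    rw [Fintype.card_piFinset]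
    simp only [h3, prod_const, card_univ, Fintype.card_fin]
  rw [e]
  refine Finset.card_le_card_of_injOn (fun p r => (p.1 r, p.2 r)) ?_ ?_
  · intro p hp
    simpa [Fintype.mem_piFinset] using hp
  · intro p _ q _ h
    refine Prod.ext (funext fun r => ?_) (funext fun r => ?_)
    · exact congrArg Prod.fst (congrFun h r)
    · exact congrArg Prod.snd (congrFun h r)

/-- The column sequences with allowed columns. -/
noncomputable abbrev columnSequences (m k : ℕ) : Finset (Fin m → Fin k → Bool) :=
  Fintype.piFinset fun _ => halfColumns k

theorem card_columnSequences (m k : ℕ) : (columnSequences m k).card = (halfColumns k).card ^ m := by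
  simp [columnSequences]

open scoped Classical in
/-- The column sequences in which one column determines another on its zeros. -/
noncomputable def dependentSequences (m k : ℕ) : Finset (Fin m → Fin k → Bool) :=
  (columnSequences m k).filter fun A =>
    ∃ i j : Fin m, i ≠ j ∧ ∃ b : Bool, ∀ r, A i r = false → A j r = b

open scoped Classical in
/-- The column sequences of labelled matrices of zeros of functions from `Phi m k`. -/
noncomputable def reducedSequences (m k : ℕ) : Finset (Fin m → Fin k → Bool) :=
  (columnSequences m k).filter fun A =>
    (∀ i j, i ≠ j → A i ≠ A j ∧ A i ≠ fun r => !A j r) ∧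
    ∀ r s, r ≠ s → ∀ j, ∃ l, l ≠ j ∧ A l r ≠ A l s

theorem card_dependentSequences_le (m k : ℕ) :
    (dependentSequences m k).card * (halfColumns k).card ^ 2 ≤
      2 * m ^ 2 * 3 ^ k * (halfColumns k).card ^ m := by
  classical
  set E : Fin m × Fin m × Bool → Finset (Fin m → Fin k → Bool) := fun t =>
    if t.1 = t.2.1 then ∅ else (columnSequences m k).filter fun A =>
      (A t.1, A t.2.1) ∈ univ.filter fun p : (Fin k → Bool) × (Fin k → Bool) =>
        ∀ r, p.1 r = false → p.2 r = t.2.2 with hE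
  have hsub : dependentSequences m k ⊆ univ.biUnion E := by
    intro A hA
    obtain ⟨hA, i, j, hij, b, h⟩ := mem_filter.1 hA
    refine mem_biUnion.2 ⟨(i, j, b), mem_univ _, ?_⟩
    simp only [hE, hij, if_false]
    exact mem_filter.2 ⟨hA, mem_filter.2 ⟨mem_univ _, h⟩⟩
  have hcard : ∀ t, (E t).card * (halfColumns k).card ^ 2 ≤
      3 ^ k * (halfColumns k).card ^ m := by
    intro t
    by_cases h : t.1 = t.2.1
    · simp [hE, h]
    · simp only [hE, h, if_false]
      refine (card_filter_pair_mul_sq_le _ h _).trans ?_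
      gcongr
      exact card_implication_le k _
  calc _ ≤ (∑ t, (E t).card) * (halfColumns k).card ^ 2 := by
        gcongr
        exact (card_le_card hsub).trans card_biUnion_le
    _ = ∑ t, (E t).card * (halfColumns k).card ^ 2 := Finset.sum_mul _ _ _
    _ ≤ ∑ _t : Fin m × Fin m × Bool, 3 ^ k * (halfColumns k).card ^ m :=
        Finset.sum_le_sum fun t _ => hcard t
    _ = _ := by
        simp only [sum_const, card_univ, Fintype.card_prod, Fintype.card_fin, Fintype.card_bool,
          smul_eq_mul]
        ring

open scoped Classical in
theorem card_coincidences_le (m k : ℕ) :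
    ((columnSequences m k).filter fun A =>
      ∃ i j : Fin m, i ≠ j ∧ (A i = A j ∨ A i = fun r => !A j r)).card *
        (halfColumns k).card ^ 2 ≤ 2 * m ^ 2 * (halfColumns k).card * (halfColumns k).card ^ m := by
  set R : Finset ((Fin k → Bool) × (Fin k → Bool)) :=
    (halfColumns k).image (fun c => (c, c)) ∪
      (halfColumns k).image (fun c => ((fun r => !c r), c)) with hR
  have hRc : R.card ≤ 2 * (halfColumns k).card := by
    rw [two_mul]
    exact (card_union_le _ _).trans (add_le_add card_image_le card_image_le)
  set E : Fin m × Fin m → Finset (Fin m → Fin k → Bool) := fun t =>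
    if t.1 = t.2 then ∅ else (columnSequences m k).filter fun A => (A t.1, A t.2) ∈ R with hE
  have hsub : ((columnSequences m k).filter fun A =>
      ∃ i j : Fin m, i ≠ j ∧ (A i = A j ∨ A i = fun r => !A j r)) ⊆ univ.biUnion E := by
    intro A hA
    obtain ⟨hA, i, j, hij, h⟩ := mem_filter.1 hA
    refine mem_biUnion.2 ⟨(i, j), mem_univ _, ?_⟩
    simp only [hE, hij, if_false]
    refine mem_filter.2 ⟨hA, ?_⟩
    have hj := Fintype.mem_piFinset.1 hA j
    rcases h with h | h
    · exact mem_union_left _ (mem_image.2 ⟨A j, hj, by rw [h]⟩)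
    · exact mem_union_right _ (mem_image.2 ⟨A j, hj, by rw [h]⟩)
  have hcard : ∀ t, (E t).card * (halfColumns k).card ^ 2 ≤
      2 * (halfColumns k).card * (halfColumns k).card ^ m := by
    intro t
    by_cases h : t.1 = t.2
    · simp [hE, h]
    · simp only [hE, h, if_false]
      refine (card_filter_pair_mul_sq_le _ h _).trans ?_
      gcongr
  calc _ ≤ (∑ t, (E t).card) * (halfColumns k).card ^ 2 := by
        gcongr
        exact (card_le_card hsub).trans card_biUnion_le
    _ = ∑ t, (E t).card * (halfColumns k).card ^ 2 := Finset.sum_mul _ _ _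
    _ ≤ ∑ _t : Fin m × Fin m, 2 * (halfColumns k).card * (halfColumns k).card ^ m :=
        Finset.sum_le_sum fun t _ => hcard t
    _ = _ := by
        simp only [sum_const, card_univ, Fintype.card_prod, Fintype.card_fin, smul_eq_mul]
        ring

-- Two fixed rows agree in at most 3/4 of the allowed columns (`card_agree_le`); the column `j` is
-- left free, hence the exponent `m - 1`.
open scoped Classical in
theorem card_closeRows_le (m k : ℕ) :
    4 ^ (m - 1) * ((columnSequences m k).filter fun A =>
      ∃ r s : Fin k, r ≠ s ∧ ∃ j, ∀ l, l ≠ j → A l r = A l s).card ≤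
        k ^ 2 * m * 3 ^ (m - 1) * (halfColumns k).card ^ m := by
  set E : Fin k × Fin k × Fin m → Finset (Fin m → Fin k → Bool) := fun t =>
    if t.1 = t.2.1 then ∅ else Fintype.piFinset fun l => if l = t.2.2 then halfColumns k else
      (halfColumns k).filter fun c => c t.1 = c t.2.1 with hE
  have hsub : ((columnSequences m k).filter fun A =>
      ∃ r s : Fin k, r ≠ s ∧ ∃ j, ∀ l, l ≠ j → A l r = A l s) ⊆ univ.biUnion E := by
    intro A hA
    obtain ⟨hA, r, s, hrs, j, h⟩ := mem_filter.1 hA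
    refine mem_biUnion.2 ⟨(r, s, j), mem_univ _, ?_⟩
    simp only [hE, hrs, if_false]
    refine Fintype.mem_piFinset.2 fun l => ?_
    have hl := Fintype.mem_piFinset.1 hA l
    by_cases hlj : l = j
    · simpa [hlj] using hlj ▸ hl
    · simp only [hlj, if_false]
      exact mem_filter.2 ⟨hl, h l hlj⟩
  have hcard : ∀ t, 4 ^ (m - 1) * (E t).card ≤ 3 ^ (m - 1) * (halfColumns k).card ^ m := by
    intro t
    by_cases h : t.1 = t.2.1
    · simp [hE, h]
    · have hm : 0 < m := t.2.2.pos
      have hc : (E t).card = (halfColumns k).card *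
          ((halfColumns k).filter fun c => c t.1 = c t.2.1).card ^ (m - 1) := by
        simp only [hE, h, if_false, Fintype.card_piFinset]
        rw [← Finset.mul_prod_erase univ _ (mem_univ t.2.2)]
        simp only [if_true]
        congr 1
        rw [Finset.prod_congr rfl (g := fun _ =>
          ((halfColumns k).filter fun c => c t.1 = c t.2.1).card)]
        · simp
        · intro l hl
          simp [(mem_erase.1 hl).1]
      rw [hc]
      calc _ = (halfColumns k).card *
            (4 * ((halfColumns k).filter fun c => c t.1 = c t.2.1).card) ^ (m - 1) := by
            rw [mul_pow]; ring
        _ ≤ (halfColumns k).card * (3 * (halfColumns k).card) ^ (m - 1) := by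
            gcongr (halfColumns k).card * ?_ ^ (m - 1)
            exact card_agree_le h
        _ = 3 ^ (m - 1) * ((halfColumns k).card * (halfColumns k).card ^ (m - 1)) := by
            rw [mul_pow]; ring
        _ = _ := by rw [← pow_succ', Nat.sub_add_cancel hm]
  calc _ ≤ 4 ^ (m - 1) * ∑ t, (E t).card := by
        gcongr
        exact (card_le_card hsub).trans card_biUnion_le
    _ = ∑ t, 4 ^ (m - 1) * (E t).card := Finset.mul_sum _ _ _
    _ ≤ ∑ _t : Fin k × Fin k × Fin m, 3 ^ (m - 1) * (halfColumns k).card ^ m :=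
        Finset.sum_le_sum fun t _ => hcard t
    _ = _ := by
        simp only [sum_const, card_univ, Fintype.card_prod, Fintype.card_fin, smul_eq_mul]
        ring

theorem card_columnSequences_le {m : ℕ} (hm : 0 < m) (k : ℕ) : ((halfColumns k).card : ℝ) ^ m ≤
    (reducedSequences m k).card + (2 * m ^ 2 / (halfColumns k).card +
      k ^ 2 * m * (3 / 4) ^ (m - 1)) * ((halfColumns k).card : ℝ) ^ m := by
  classical
  -- Without allowed columns `h ^ m = 0` because `0 < m`, so the division by zero is harmless.
  rcases Nat.eq_zero_or_pos (halfColumns k).card with h0 | hpos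
  · rw [h0]; simp [hm.ne']
  have h1 := card_coincidences_le m k
  have h2 := card_closeRows_le m k
  set X := (columnSequences m k).filter fun A =>
      ∃ i j : Fin m, i ≠ j ∧ (A i = A j ∨ A i = fun r => !A j r)
  set Y := (columnSequences m k).filter fun A =>
      ∃ r s : Fin k, r ≠ s ∧ ∃ j, ∀ l, l ≠ j → A l r = A l s
  have h3 : (columnSequences m k).card ≤ (reducedSequences m k).card + (X.card + Y.card) := by
    refine (card_le_card (t := reducedSequences m k ∪ (X ∪ Y)) ?_).trans
      ((card_union_le _ _).trans (by gcongr; exact card_union_le _ _))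
    intro A hA
    by_cases hX : A ∈ X
    · exact mem_union_right _ (mem_union_left _ hX)
    by_cases hY : A ∈ Y
    · exact mem_union_right _ (mem_union_right _ hY)
    refine mem_union_left _ (mem_filter.2 ⟨hA, fun i j hij => ?_, fun r s hrs j => ?_⟩)
    · by_contra h
      refine hX (mem_filter.2 ⟨hA, i, j, hij, ?_⟩)
      tauto
    · by_contra! h
      exact hY (mem_filter.2 ⟨hA, r, s, hrs, j, h⟩)
  rw [card_columnSequences] at h3
  set h := (halfColumns k).card
  have hR : (0 : ℝ) < h := by exact_mod_cast hpos
  have h1' : (X.card : ℝ) * h ^ 2 ≤ 2 * m ^ 2 * h * h ^ m := by exact_mod_cast h1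
  have h2' : (4 : ℝ) ^ (m - 1) * Y.card ≤ k ^ 2 * m * 3 ^ (m - 1) * h ^ m := by exact_mod_cast h2
  have h3' : (h : ℝ) ^ m ≤ (reducedSequences m k).card + (X.card + Y.card) := by exact_mod_cast h3
  have hX : (X.card : ℝ) ≤ 2 * m ^ 2 / h * h ^ m := by
    rw [div_mul_eq_mul_div, le_div_iff₀ hR]
    nlinarith
  have hY : (Y.card : ℝ) ≤ k ^ 2 * m * (3 / 4) ^ (m - 1) * h ^ m := by
    have : (k : ℝ) ^ 2 * m * (3 / 4) ^ (m - 1) * h ^ m =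
        (k ^ 2 * m * 3 ^ (m - 1) * h ^ m) / 4 ^ (m - 1) := by
      rw [div_pow]; ring
    rw [this, le_div_iff₀ (by positivity)]
    linarith
  linarith

/-! ### Functions with labelled zeros as column sequences -/

/-- The column sequence of a labelling of the zeros of a function. -/
def labelledColumns {m k : ℕ} (p : (f : BoolFun m) × (Fin k ≃ Zero f)) : Fin m → Fin k → Bool :=
  fun i r => (p.2 r).1 i

/-- The rows list the zeros, which determine `f`; their order determines the labelling. -/
theorem labelledColumns_injective {m k : ℕ} :
    Function.Injective (labelledColumns (m := m) (k := k)) := by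
  rintro ⟨f, e⟩ ⟨g, e'⟩ h
  have hr : ∀ r, (e r).1 = (e' r).1 := fun r => funext fun i => congrFun (congrFun h i) r
  have hfg : f = g := by
    have hz : ∀ x, f x = false ↔ g x = false := by
      intro x
      constructor
      · intro hx
        have := hr (e.symm ⟨x, hx⟩)
        rw [Equiv.apply_symm_apply] at this
        change x = _ at this
        rw [this]
        exact (e' _).2
      · intro hx
        have := hr (e'.symm ⟨x, hx⟩)
        rw [Equiv.apply_symm_apply] at this
        change _ = x at this
        rw [← this]
        exact (e _).2
    funext x
    have := hz x
    revert this
    cases f x <;> cases g x <;> simp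
  subst hfg
  have : e = e' := Equiv.ext fun r => Subtype.ext (hr r)
  rw [this]

theorem labelledColumns_mem_columnSequences {m k : ℕ} {f : BoolFun m} (hf : f ∈ Phi m k)
    (e : Fin k ≃ Zero f) : labelledColumns ⟨f, e⟩ ∈ columnSequences m k := by
  refine Fintype.mem_piFinset.2 fun i => mem_halfColumns.2 ⟨fun b h => ?_, ?_⟩
  · refine hf.1.not_constant i b (funext fun z => ?_)
    have := congrFun h (e.symm z)
    simpa [labelledColumns, zeroColumn, zeroMatrix] using this
  · have hc : ∀ b, Fintype.card {r // labelledColumns ⟨f, e⟩ i r = b} = columnCount f i b :=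
      fun b => Fintype.card_congr (e.subtypeEquiv fun r => Iff.rfl)
    rw [hc, hc]
    exact hf.2.2.2 i

theorem exists_labelledColumns_eq {m k : ℕ} {A : Fin m → Fin k → Bool}
    (hA : A ∈ reducedSequences m k) (hm : 0 < m) :
    ∃ f ∈ Phi m k, ∃ e : Fin k ≃ Zero f, labelledColumns ⟨f, e⟩ = A := by
  classical
  obtain ⟨hA, hcol, hrow⟩ := mem_filter.1 hA
  have hH := Fintype.mem_piFinset.1 hA
  let row : Fin k → Fin m → Bool := fun r i => A i r
  have hrowinj : Function.Injective row := by
    intro r s h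
    by_contra hrs
    -- The row condition is vacuous for `m = 0`; any excluded index serves here.
    obtain ⟨l, -, hl⟩ := hrow r s hrs ⟨0, hm⟩
    exact hl (congrFun h l)
  let f : BoolFun m := fun x => decide (∀ r, row r ≠ x)
  have hz : ∀ r, f (row r) = false := fun r => by simp [f]
  let e : Fin k ≃ Zero f := Equiv.ofBijective (fun r => ⟨row r, hz r⟩) (by
    constructor
    · intro r s h
      exact hrowinj (congrArg Subtype.val h)
    · rintro ⟨x, hx⟩
      have : ∃ r, row r = x := by simpa [f] using hx
      obtain ⟨r, hr⟩ := this
      exact ⟨r, Subtype.ext hr⟩)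
  have he : ∀ r i, (e r).1 i = A i r := fun r i => rfl
  refine ⟨f, ⟨⟨fun i b h => ?_, fun i j hij h => ?_, fun i j hij h => ?_⟩, ?_, ?_, ?_⟩, e, rfl⟩
  · exact (mem_halfColumns.1 (hH i)).1 b (funext fun r => congrFun h (e r))
  · exact (hcol i j hij).1 (funext fun r => congrFun h (e r))
  · exact (hcol i j hij).2 (funext fun r => congrFun h (e r))
  · rw [← Fintype.card_congr e, Fintype.card_fin]
  · intro y z h
    obtain ⟨r, rfl⟩ := e.surjective y
    obtain ⟨s, rfl⟩ := e.surjective z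
    obtain ⟨j, hj⟩ := Finset.card_eq_one.1 h
    have hrs : r ≠ s := by
      rintro rfl
      simp at h
    obtain ⟨l, hl, hne⟩ := hrow r s hrs j
    have : l ∈ ({j} : Finset (Fin m)) := hj ▸ mem_filter.2 ⟨mem_univ _, hne⟩
    exact hl (mem_singleton.1 this)
  · intro i
    have hc : ∀ b, Fintype.card {r // A i r = b} = columnCount f i b :=
      fun b => Fintype.card_congr (e.subtypeEquiv fun r => Iff.rfl)
    rw [← hc, ← hc]
    exact (mem_halfColumns.1 (hH i)).2

theorem card_sigma_labellings {m k : ℕ} (S : Finset (BoolFun m))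
    (hS : ∀ f ∈ S, Fintype.card (Zero f) = k) :
    (S.sigma fun f => (univ : Finset (Fin k ≃ Zero f))).card = S.card * k.factorial := by
  rw [Finset.card_sigma, Finset.sum_const_nat]
  intro f hf
  have e : Fin k ≃ Zero f := Fintype.equivOfCardEq (by rw [hS f hf, Fintype.card_fin])
  rw [card_univ, Fintype.card_equiv e, Fintype.card_fin]

theorem card_reducedSequences_le {m k : ℕ} (hm : 0 < m) :
    (reducedSequences m k).card ≤ (Phi m k).ncard * k.factorial := by
  classical
  rw [Set.ncard_eq_toFinset_card', ← card_sigma_labellings _ (fun f hf => (Set.mem_toFinset.1 hf).2.1)]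
  refine Finset.card_le_card_of_surjOn labelledColumns fun A hA => ?_
  obtain ⟨f, hf, e, he⟩ := exists_labelledColumns_eq (mem_coe.1 hA) hm
  exact ⟨⟨f, e⟩, by simpa using hf, he⟩

theorem ncard_not_isIndependent_le (m k : ℕ) :
    {f | f ∈ Phi m k ∧ ¬ IsIndependent f}.ncard * k.factorial ≤ (dependentSequences m k).card := by
  classical
  rw [Set.ncard_eq_toFinset_card',
    ← card_sigma_labellings _ (fun f hf => (Set.mem_toFinset.1 hf).1.2.1)]
  refine Finset.card_le_card_of_injOn labelledColumns ?_ labelledColumns_injective.injOn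
  rintro ⟨f, e⟩ hf
  simp only [coe_sigma, Set.mem_sigma_iff, mem_coe, Set.mem_toFinset, Set.mem_ofPred_eq] at hf
  obtain ⟨⟨hf, hI⟩, -⟩ := hf
  refine mem_filter.2 ⟨labelledColumns_mem_columnSequences hf e, ?_⟩
  rw [IsIndependent] at hI
  push Not at hI
  obtain ⟨i, j, hij, b, h⟩ := hI
  exact ⟨i, j, hij, b, fun r hr => h (e r) hr⟩

/-! ### Almost all functions are independent -/

theorem pow_le_two_pow {m k : ℕ} (hm : 0 < m) (hk : Real.log m ≤ (k : ℝ) / 32) :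
    (m : ℝ) ^ 16 ≤ 2 ^ k := by
  have hm' : (0 : ℝ) < m := by exact_mod_cast hm
  rw [← Real.log_le_log_iff (by positivity) (by positivity), Real.log_pow, Real.log_pow]
  have h2 := Real.log_two_gt_d9
  have hk0 : (0 : ℝ) ≤ k := by positivity
  push_cast
  nlinarith

/-- After taking logarithms: `8 log m ≤ k/4 ≤ k log(4/3)`. This is what makes `3^k` negligible
against `h² ≥ 4^k/16`. -/
theorem pow_mul_three_pow_le {m k : ℕ} (hm : 0 < m) (hk : Real.log m ≤ (k : ℝ) / 32) :
    (m : ℝ) ^ 8 * 3 ^ k ≤ 4 ^ k := by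
  have hm' : (0 : ℝ) < m := by exact_mod_cast hm
  have h3 : Real.log (3 / 4) ≤ 3 / 4 - 1 := Real.log_le_sub_one_of_pos (by norm_num)
  rw [Real.log_div (by norm_num) (by norm_num)] at h3
  rw [← Real.log_le_log_iff (by positivity) (by positivity),
    Real.log_mul (by positivity) (by positivity), Real.log_pow, Real.log_pow, Real.log_pow]
  have hk0 : (0 : ℝ) ≤ k := by positivity
  push_cast
  nlinarith

theorem ncard_not_isIndependent_le_of_large {m k : ℕ} {ε : ℝ} (hm : 32 ≤ m) (hε : 64 / m ≤ ε)
    (hdec : (162 ^ 2 * (4 / 3)) * ((m : ℝ) ^ 3 * (3 / 4) ^ m) ≤ 1 / 4)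
    (hk : Real.log m ≤ (k : ℝ) / 32) (hk' : (k : ℝ) / 162 < Real.log m) :
    ({f | f ∈ Phi m k ∧ ¬ IsIndependent f}.ncard : ℝ) ≤ ε * (Phi m k).ncard := by
  have hm0 : 0 < m := by omega
  have hmR : (32 : ℝ) ≤ m := by exact_mod_cast hm
  have hmpos : (0 : ℝ) < m := by linarith
  have hlog : Real.log m ≤ m := (Real.log_le_sub_one_of_pos hmpos).trans (by linarith)
  have hk2 : 2 ≤ k := by
    have h1 : Real.log 2 ≤ Real.log m := Real.log_le_log (by norm_num) (by linarith)
    have h2 := Real.log_two_gt_d9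
    have : (2 : ℝ) ≤ k := by linarith
    exact_mod_cast this
  have hH : (2 : ℝ) ^ k ≤ 4 * (halfColumns k).card := by
    exact_mod_cast two_pow_le_card_halfColumns hk2
  have hcol := card_columnSequences_le hm0 k
  have hdep : ((dependentSequences m k).card : ℝ) * ((halfColumns k).card : ℝ) ^ 2 ≤
      2 * m ^ 2 * 3 ^ k * (halfColumns k).card ^ m := by
    exact_mod_cast card_dependentSequences_le m k
  have hred : ((reducedSequences m k).card : ℝ) ≤ (Phi m k).ncard * k.factorial := by
    exact_mod_cast card_reducedSequences_le hm0
  have hbad : ({f | f ∈ Phi m k ∧ ¬ IsIndependent f}.ncard : ℝ) * k.factorial ≤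
      (dependentSequences m k).card := by
    exact_mod_cast ncard_not_isIndependent_le m k
  set h : ℝ := ((halfColumns k).card : ℝ)
  have hpos : 0 < h := by
    have : (0 : ℝ) < 2 ^ k := by positivity
    linarith
  have h16 := pow_le_two_pow hm0 hk
  have h8 := pow_mul_three_pow_le hm0 hk
  -- Here `4h ≥ 2^k ≥ m³ ≥ 32m²`, the last step by `32 ≤ m`.
  have hcoin : 2 * (m : ℝ) ^ 2 / h ≤ 1 / 4 := by
    rw [div_le_iff₀ hpos]
    have : (m : ℝ) ^ 3 ≤ m ^ 16 := pow_le_pow_right₀ (by linarith) (by norm_num)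
    nlinarith [sq_nonneg (m : ℝ)]
  have hclose : (k : ℝ) ^ 2 * m * (3 / 4) ^ (m - 1) ≤ 1 / 4 := by
    refine le_trans ?_ hdec
    -- The lower bound on `log m` enters here: `k` must not be too large for `k²·m·(3/4)^(m-1)` to
    -- be small.
    have hkm : (k : ℝ) ≤ 162 * m := by linarith
    have e : (3 / 4 : ℝ) ^ m = (3 / 4) ^ (m - 1) * (3 / 4) := by
      rw [← pow_succ, Nat.sub_add_cancel hm0]
    calc (k : ℝ) ^ 2 * m * (3 / 4) ^ (m - 1) ≤ (162 * m) ^ 2 * m * (3 / 4) ^ (m - 1) := by gcongr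
      _ = _ := by rw [e]; ring
  have hN : h ^ m ≤ 2 * ((Phi m k).ncard * k.factorial) := by
    have : (2 * (m : ℝ) ^ 2 / h + k ^ 2 * m * (3 / 4) ^ (m - 1)) * h ^ m ≤ 1 / 2 * h ^ m := by
      gcongr
      linarith
    linarith
  have hratio : 2 * (m : ℝ) ^ 2 * 3 ^ k ≤ ε / 2 * h ^ 2 := by
    have h4 : (4 : ℝ) ^ k ≤ 16 * h ^ 2 := by
      calc (4 : ℝ) ^ k = (2 ^ k) ^ 2 := by rw [← pow_mul, mul_comm, pow_mul]; norm_num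
        _ ≤ (4 * h) ^ 2 := by gcongr
        _ = _ := by ring
    have h3 : (m : ℝ) * ((m : ℝ) ^ 2 * 3 ^ k) ≤ 16 * h ^ 2 := by
      calc (m : ℝ) * ((m : ℝ) ^ 2 * 3 ^ k) = (m : ℝ) ^ 3 * 3 ^ k := by ring
        _ ≤ (m : ℝ) ^ 8 * 3 ^ k := by
          gcongr
          · linarith
          · norm_num
        _ ≤ _ := h8.trans h4
    have h3' : (m : ℝ) ^ 2 * 3 ^ k ≤ 16 * h ^ 2 / m := by
      rw [le_div_iff₀ hmpos]; linarith
    calc 2 * (m : ℝ) ^ 2 * 3 ^ k ≤ 2 * (16 * h ^ 2 / m) := by linarith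
      _ = (64 / m) / 2 * h ^ 2 := by ring
      _ ≤ _ := by gcongr
  have hε0 : 0 ≤ ε := le_trans (by positivity) hε
  have hD : ((dependentSequences m k).card : ℝ) ≤ ε / 2 * h ^ m := by
    refine le_of_mul_le_mul_right ?_ (by positivity : 0 < h ^ 2)
    calc _ ≤ 2 * (m : ℝ) ^ 2 * 3 ^ k * h ^ m := hdep
      _ ≤ ε / 2 * h ^ 2 * h ^ m := by gcongr
      _ = _ := by ring
  refine le_of_mul_le_mul_right ?_ (by positivity : (0 : ℝ) < k.factorial)
  calc _ ≤ ε / 2 * h ^ m := hbad.trans hD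
    _ ≤ ε / 2 * (2 * ((Phi m k).ncard * k.factorial)) := by gcongr
    _ = _ := by ring

theorem almostAll_isIndependent :
    AlmostAll (fun m k => Real.log (m : ℝ) ≤ (k : ℝ) / 32 ∧ (k : ℝ) / 162 < Real.log (m : ℝ))
      (fun _ _ f => IsIndependent f) := by
  intro δ hδ
  have t1 : Filter.Tendsto (fun m : ℕ => (162 ^ 2 * (4 / 3)) * ((m : ℝ) ^ 3 * (3 / 4) ^ m))
      Filter.atTop (nhds 0) := by
    have := (tendsto_pow_const_mul_const_pow_of_abs_lt_one 3 (r := (3 / 4 : ℝ))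
      (by rw [abs_lt]; norm_num)).const_mul (162 ^ 2 * (4 / 3) : ℝ)
    simpa using this
  have t2 : Filter.Tendsto (fun m : ℕ => (64 : ℝ) / m) Filter.atTop (nhds 0) :=
    tendsto_const_div_atTop_nhds_zero_nat 64
  obtain ⟨M, hM⟩ := Filter.eventually_atTop.1
    ((t1.eventually (Iic_mem_nhds (by norm_num : (0 : ℝ) < 1 / 4))).and
      ((t2.eventually (Iic_mem_nhds hδ)).and (Filter.eventually_ge_atTop 32)))
  refine ⟨M, fun m k hm hR => ?_⟩
  obtain ⟨hdec, hδm, h32⟩ := hM m hm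
  have hle := ncard_not_isIndependent_le_of_large h32 hδm hdec hR.1 hR.2
  have hsplit : (Phi m k).ncard = {f | f ∈ Phi m k ∧ IsIndependent f}.ncard +
      {f | f ∈ Phi m k ∧ ¬ IsIndependent f}.ncard := by
    rw [← Set.ncard_union_eq]
    · congr 1
      ext f
      simp only [Set.mem_union, Set.mem_ofPred_eq]
      tauto
    · rw [Set.disjoint_left]
      exact fun f hf hf' => hf'.2 hf.2
  have : ((Phi m k).ncard : ℝ) = {f | f ∈ Phi m k ∧ IsIndependent f}.ncard +
      {f | f ∈ Phi m k ∧ ¬ IsIndependent f}.ncard := by exact_mod_cast hsplit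
  linarith

/-! ### Comparison with the bounds in `λ` -/

theorem ncard_inter_mono {m k : ℕ} {P Q : BoolFun m → Prop} (h : ∀ f ∈ Phi m k, P f → Q f) :
    (({f | f ∈ Phi m k ∧ P f} : Set (BoolFun m)).ncard : ℝ) ≤
      (({f | f ∈ Phi m k ∧ Q f} : Set (BoolFun m)).ncard : ℝ) := by
  have hsub : {f | f ∈ Phi m k ∧ P f} ⊆ {f | f ∈ Phi m k ∧ Q f} :=
    fun f hf => ⟨hf.1, h f hf.1 hf.2⟩
  exact_mod_cast Set.ncard_le_ncard hsub

theorem lam_nonneg {α : ℝ} (hα : 0 < α) (m k : ℕ) : 0 ≤ lam α m k :=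
  mul_nonneg hα.le (Real.sqrt_nonneg _)

theorem lam_le_of_log_le {α c : ℝ} (hα1 : α < 1) (hc : 0 ≤ c) {m k : ℕ}
    (h : 2 * Real.log m ≤ c ^ 2 * k) : lam α m k ≤ c := by
  have hs : Real.sqrt (2 * Real.log m / k) ≤ c := by
    rw [Real.sqrt_le_left hc]
    exact div_le_of_le_mul₀ (by positivity) (by positivity) h
  calc lam α m k ≤ 1 * Real.sqrt (2 * Real.log m / k) := by
        unfold lam
        gcongr
    _ ≤ c := by rwa [one_mul]

end DNFBound

theorem mainTheorem2 (α : ℝ) (hα0 : 0 < α) (hα1 : α < 1) :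
    DNFBound.AlmostAll
      (fun m k => Real.log (m : ℝ) ≤ (k : ℝ) / 32)
      (fun m k f => ∀ D : DNFBound.DNF m, DNFBound.DNF.IsMinimal D f →
        10 / 3 * (m : ℝ)
            - 5 * (m : ℝ) * (1 - DNFBound.lam α m k) / (3 + 3 * DNFBound.lam α m k)
          ≤ (DNFBound.DNF.rank D : ℝ)) ∧
    DNFBound.AlmostAll
      (fun m k => (k : ℝ) / 162 < Real.log (m : ℝ) ∧ Real.log (m : ℝ) < (k : ℝ) / 32)
      (fun m k f => ∀ D : DNFBound.DNF m, DNFBound.DNF.IsMinimal D f →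
        10 / 3 * (m : ℝ)
            - 13 * (m : ℝ) * (1 - DNFBound.lam α m k) / (9 + 3 * DNFBound.lam α m k)
          ≤ (DNFBound.DNF.rank D : ℝ)) := by
  open DNFBound in
  refine ⟨fun δ hδ => ?_, fun δ hδ => ?_⟩
  · obtain ⟨M, hM⟩ := almostAll_isIndependent δ hδ
    refine ⟨M, fun m k hm hk => ?_⟩
    have hl0 := lam_nonneg hα0 m k
    have hm0 : (0 : ℝ) ≤ m := Nat.cast_nonneg m
    -- The threshold is `162 = 2·9²`: below it `λ ≤ 1/9`, and at `λ = 1/9` the bound equals exactly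
    -- `2m`.
    by_cases hk' : (k : ℝ) / 162 < Real.log m
    · refine (hM m k hm ⟨hk, hk'⟩).trans (ncard_inter_mono fun f hf hI D hD => ?_)
      have hr : (3 : ℝ) * m ≤ D.rank := by exact_mod_cast three_mul_le_rank hf hI hD.1
      have hl : lam α m k ≤ 1 / 4 := lam_le_of_log_le hα1 (by norm_num) (by linarith)
      -- Subtracting `m/3` already brings the bound down to `3m`; the quotient is at least `m` for
      -- `λ ≤ 1/4`.
      have : 1 / 3 * (m : ℝ) ≤ 5 * m * (1 - lam α m k) / (3 + 3 * lam α m k) := by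
        rw [le_div_iff₀ (by linarith)]
        nlinarith
      linarith
    · rw [not_lt] at hk'
      -- No exceptional functions occur in this range.
      have h1 : (1 - δ) * ((Phi m k).ncard : ℝ) ≤ {f | f ∈ Phi m k ∧ True}.ncard := by
        have : (0 : ℝ) ≤ (Phi m k).ncard := Nat.cast_nonneg _
        simp only [and_true, Set.ofPred_mem_eq]
        nlinarith
      refine h1.trans (ncard_inter_mono fun f hf _ D hD => ?_)
      have hr : (2 : ℝ) * m ≤ D.rank := by exact_mod_cast two_mul_le_rank hf hD.1
      have hl : lam α m k ≤ 1 / 9 := lam_le_of_log_le hα1 (by norm_num) (by linarith)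
      have : 4 / 3 * (m : ℝ) ≤ 5 * m * (1 - lam α m k) / (3 + 3 * lam α m k) := by
        rw [le_div_iff₀ (by linarith)]
        nlinarith
      linarith
  · obtain ⟨M, hM⟩ := almostAll_isIndependent δ hδ
    refine ⟨M, fun m k hm hk => ?_⟩
    have hl0 := lam_nonneg hα0 m k
    have hm0 : (0 : ℝ) ≤ m := Nat.cast_nonneg m
    refine (hM m k hm ⟨hk.2.le, hk.1⟩).trans (ncard_inter_mono fun f hf hI D hD => ?_)
    have hr : (3 : ℝ) * m ≤ D.rank := by exact_mod_cast three_mul_le_rank hf hI hD.1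
    have hl : lam α m k ≤ 1 / 4 := lam_le_of_log_le hα1 (by norm_num) (by linarith [hk.2])
    have : 1 / 3 * (m : ℝ) ≤ 13 * m * (1 - lam α m k) / (9 + 3 * lam α m k) := by
      rw [le_div_iff₀ (by linarith)]
      nlinarith
    linarith
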